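/- Let $\mathbb F\in\{\mathbb R,\mathbb C\}$ and let $d_{\ell-1},d_\ell,d_{\ell+1}\ge 2$ and $r_\ell\ge 2$ be integers. For parameters $\theta=(W_1,W_2,b_1,b_2)$ with $W_1\in\mathbb F^{d_\ell\times d_{\ell-1}}$, $W_2\in\mathbb F^{d_{\ell+1}\times d_\ell}$, $b_1\in\mathbb F^{d_\ell}$, $b_2\in\mathbb F^{d_{\ell+1}}$, the 2-layer polynomial neural network (PNN) with biases of architecture $((d_{\ell-1},d_\ell,d_{\ell+1}),(r_\ell))$ is the map $$p_\theta:\mathbb F^{d_{\ell-1}}\to\mathbb F^{d_{\ell+1}},\qquad p_\theta(x)=W_2\,\rho_{r_\ell}(W_1x+b_1)+b_2,\qquad \rho_r(z_1,\dots,z_d)=(z_1^r,\dots,z_d^r).$$ Call $\theta'$ equivalent to $\theta$ if there are a permutation matrix $P$ and an invertible diagonal matrix $D$ of size $d_\ell$ with $W_1'=PDW_1$, $b_1'=PDb_1$, $W_2'=W_2D^{-r_\ell}P^{\mathsf T}$, $b_2'=b_2$. The architecture is called identifiable over $\mathbb F$ if for all $\theta$ outside a set of Lebesgue measure zero, every $\theta'$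 with $p_{\theta'}=p_\theta$ is equivalent to $\theta$. If $$r_\ell\;\ge\;2\left\lceil\frac{2(d_\ell+1)-\min(d_\ell+1,\,d_{\ell+1})}{2\min(d_\ell+1,\,d_{\ell-1}+1)-2}\right\rceil,$$ then the 2-layer PNN with biases of architecture $((d_{\ell-1},d_\ell,d_{\ell+1}),(r_\ell))$ is identifiable, both over $\mathbb R$ and over $\mathbb C$. -/

import Mathlib

open MeasureTheory

namespace PNN

/-- The parameters `θ = ((W₁, W₂), (b₁, b₂))` of a two-layer network of widths `(d₀, d₁, d₂)`:
weights `W₁ ∈ 𝕜^{d₁ × d₀}`, `W₂ ∈ 𝕜^{d₂ × d₁}` (given by their entries) and biases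
`b₁ ∈ 𝕜^{d₁}`, `b₂ ∈ 𝕜^{d₂}`. As an iterated product of copies of `𝕜` this space carries the
product (Lebesgue) measure `volume`. -/
abbrev Params (𝕜 : Type*) (d₀ d₁ d₂ : ℕ) : Type _ :=
  ((Fin d₁ → Fin d₀ → 𝕜) × (Fin d₂ → Fin d₁ → 𝕜)) × ((Fin d₁ → 𝕜) × (Fin d₂ → 𝕜))

section

variable {𝕜 : Type*} {d₀ d₁ d₂ : ℕ}

/-- The first weight matrix. -/
def Params.W₁ (θ : Params 𝕜 d₀ d₁ d₂) : Matrix (Fin d₁) (Fin d₀) 𝕜 := Matrix.of θ.1.1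

/-- The second weight matrix. -/
def Params.W₂ (θ : Params 𝕜 d₀ d₁ d₂) : Matrix (Fin d₂) (Fin d₁) 𝕜 := Matrix.of θ.1.2

/-- The bias of the hidden layer. -/
def Params.b₁ (θ : Params 𝕜 d₀ d₁ d₂) : Fin d₁ → 𝕜 := θ.2.1

/-- The bias of the output layer. -/
def Params.b₂ (θ : Params 𝕜 d₀ d₁ d₂) : Fin d₂ → 𝕜 := θ.2.2

end

/-- The monomial activation `ρ_r (z₁, …, z_d) = (z₁ ^ r, …, z_d ^ r)`. -/
def activation {𝕜 : Type*} [Field 𝕜] {d : ℕ} (r : ℕ) (z : Fin d → 𝕜) : Fin d → 𝕜 :=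
  fun i => z i ^ r

/-- The two-layer polynomial neural network with biases
`x ↦ W₂ ρ_r (W₁ x + b₁) + b₂`, as a function `𝕜^{d₀} → 𝕜^{d₂}`. -/
def network {𝕜 : Type*} [Field 𝕜] {d₀ d₁ d₂ : ℕ} (r : ℕ) (θ : Params 𝕜 d₀ d₁ d₂) :
    (Fin d₀ → 𝕜) → (Fin d₂ → 𝕜) :=
  fun x => θ.W₂.mulVec (activation r (θ.W₁.mulVec x + θ.b₁)) + θ.b₂

/-- Equivalence of parameters: `θ'` arises from `θ` by a permutation matrix `P` and an invertible
diagonal matrix `D = diag(c)` acting on the hidden layer,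
`W₁' = P D W₁`, `b₁' = P D b₁`, `W₂' = W₂ D^{-r} Pᵀ`, `b₂' = b₂`. -/
def Equivalent {𝕜 : Type*} [Field 𝕜] {d₀ d₁ d₂ : ℕ} (r : ℕ) (θ θ' : Params 𝕜 d₀ d₁ d₂) : Prop :=
  ∃ (σ : Equiv.Perm (Fin d₁)) (c : Fin d₁ → 𝕜), (∀ i, c i ≠ 0) ∧
    θ'.W₁ = σ.permMatrix 𝕜 * Matrix.diagonal c * θ.W₁ ∧
    θ'.b₁ = (σ.permMatrix 𝕜 * Matrix.diagonal c).mulVec θ.b₁ ∧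
    θ'.W₂ = θ.W₂ * Matrix.diagonal (fun i => (c i ^ r)⁻¹) * (σ.permMatrix 𝕜).transpose ∧
    θ'.b₂ = θ.b₂

/-- The network with parameters `θ` has a unique representation: all parameters (of the same
architecture) that define the same function are equivalent to `θ`. -/
def HasUniqueRepresentation {𝕜 : Type*} [Field 𝕜] {d₀ d₁ d₂ : ℕ} (r : ℕ)
    (θ : Params 𝕜 d₀ d₁ d₂) : Prop :=
  ∀ θ' : Params 𝕜 d₀ d₁ d₂, network r θ' = network r θ → Equivalent r θ θ'

/-- The two-layer architecture `((d₀, d₁, d₂), (r))` with biases is (globally) identifiable over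
`𝕜`: the representation is unique for all parameters outside a set of Lebesgue measure zero. -/
def Identifiable (𝕜 : Type*) [Field 𝕜] [MeasureSpace 𝕜] (d₀ d₁ d₂ r : ℕ) : Prop :=
  ∀ᵐ θ : Params 𝕜 d₀ d₁ d₂ ∂volume, HasUniqueRepresentation r θ

end PNN

/-! Homogenize: treat the output bias as the outer weight of an extra neuron `none` whose linear
form is the homogenizing coordinate. Equality of two networks then becomes equality of two tensors
`∑ vᵢ^{⊗r} ⊗ wᵢ` with `R = d₁ + 1` terms. Splitting `r = k + l` with `k = r / 2 ≤ l` turns this into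
a three-factor decomposition, and Kruskal's theorem (`exists_perm_smul_eq`) gives uniqueness of the
`vᵢ^{⊗k}` up to order and scale.

Generic `vᵢ` have Kruskal rank `q + 1 = min (d₁ + 1) (d₀ + 1)`; products of `k` linear forms raise
this to at least `min R (k * q + 1)` for the `k`-th tensor powers (`Separated.tensorPower`). The
degree bound is then exactly what Kruskal's inequality requires. Once the rows agree, linear
independence of the `vᵢ^{⊗r}` determines the columns `wᵢ`. Genericity is tested on Vandermonde
parameters, which respect the fixed row of `none`. -/

namespace PNN

/-! ### Kruskal's uniqueness theorem for three-factor tensor decompositions -/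

section Kruskal

open Finset Matrix Module

open scoped Classical

variable {F : Type*} [Field F] {ι κ μ : Type*}

/-- Any member of the family `a` can be separated by a linear form from any `q` other members;
equivalently, the Kruskal rank of the family is at least `min (q + 1) (card ι)`. -/
def Separated [Fintype κ] (a : ι → κ → F) (q : ℕ) : Prop :=
  ∀ (S : Finset ι) (i : ι), i ∉ S → S.card ≤ q →
    ∃ l : κ → F, (∀ j ∈ S, l ⬝ᵥ a j = 0) ∧ l ⬝ᵥ a i ≠ 0

theorem Separated.mono [Fintype κ] {a : ι → κ → F} {p q : ℕ} (h : Separated a q) (hpq : p ≤ q) :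
    Separated a p := fun S i hi hS => h S i hi (hS.trans hpq)

theorem Separated.linearIndepOn [Fintype κ] {a : ι → κ → F} {q : ℕ} (h : Separated a q)
    (I : Finset ι)
    (hI : I.card ≤ q + 1) : LinearIndependent F (fun i : I => a i) := by
  rw [Fintype.linearIndependent_iff]
  intro g hg i
  obtain ⟨l, hl, hli⟩ := h (I.erase i) i (notMem_erase _ _)
    (by rw [card_erase_of_mem i.2]; omega)
  have := congrArg (fun y => l ⬝ᵥ y) hg
  simp only [dotProduct_zero, dotProduct_sum, dotProduct_smul] at this
  rw [Finset.sum_eq_single i] at this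
  · simpa [hli] using this
  · intro j _ hj
    rw [hl j (mem_erase.2 ⟨fun e => hj (Subtype.ext e), j.2⟩), smul_zero]
  · simp

theorem Separated.le_rank [Fintype κ] {a : ι → κ → F} {q : ℕ} (h : Separated a q)
    (G : Finset ι) {s : ℕ}
    (hs : s ≤ q + 1) (hG : s ≤ G.card) :
    s ≤ (Matrix.of fun p (i : G) => a i p).rank := by
  obtain ⟨I, hIG, rfl⟩ := exists_subset_card_eq hG
  have hI := h.linearIndepOn I hs
  rw [rank_eq_finrank_span_cols, ← Fintype.card_coe, ← finrank_span_eq_card hI]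
  apply Submodule.finrank_mono
  apply Submodule.span_mono
  rintro _ ⟨i, rfl⟩
  exact ⟨⟨i, hIG i.2⟩, rfl⟩

/-- Sylvester's rank inequality. -/
theorem rank_add_rank_le_card_add_rank_mul {m n o : Type*} [Fintype m] [Fintype n] [Fintype o]
    (X : Matrix m n F) (Y : Matrix n o F) :
    X.rank + Y.rank ≤ Fintype.card n + (X * Y).rank := by
  have h1 := LinearMap.finrank_range_add_finrank_ker X.mulVecLin
  have h2 := LinearMap.finrank_range_add_finrank_ker
    (X.mulVecLin.domRestrict (LinearMap.range Y.mulVecLin))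
  have h3 : LinearMap.range (X.mulVecLin.domRestrict (LinearMap.range Y.mulVecLin)) =
      LinearMap.range (X * Y).mulVecLin := by
    rw [LinearMap.range_domRestrict, Matrix.mulVecLin_mul, LinearMap.range_comp]
  have h4 : finrank F (LinearMap.ker (X.mulVecLin.domRestrict (LinearMap.range Y.mulVecLin))) ≤
      finrank F (LinearMap.ker X.mulVecLin) := by
    rw [LinearMap.ker_domRestrict, ← Submodule.finrank_map_subtype_eq]
    apply Submodule.finrank_mono
    exact Submodule.map_comap_le _ _
  rw [h3] at h2
  rw [Module.finrank_fintype_fun_eq_card] at h1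
  unfold Matrix.rank
  omega

/-- If `∑ xᵢ bᵢ ⊗ cᵢ = ∑ x'ᵢ b'ᵢ ⊗ c'ᵢ` and `x'` has few nonzero entries, then `x` has at most as
many. -/
theorem card_support_le [Fintype ι] [Fintype κ] [Fintype μ] {b b' : ι → κ → F}
    {c c' : ι → μ → F} {β γ : ℕ}
    (hb : Separated b β) (hc : Separated c γ) {x x' : ι → F}
    (h : ∀ p s, ∑ i, x i * b i p * c i s = ∑ i, x' i * b' i p * c' i s)
    (hx' : #{i | x' i ≠ 0} + Fintype.card ι + 1 ≤
      min (Fintype.card ι) (β + 1) + min (Fintype.card ι) (γ + 1)) :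
    #{i | x i ≠ 0} ≤ #{i | x' i ≠ 0} := by
  set G : Finset ι := {i | x i ≠ 0} with hG
  have hGR : G.card ≤ Fintype.card ι := card_le_univ _
  set M : Matrix κ μ F := Matrix.of fun p s => ∑ i, x i * b i p * c i s with hM
  -- On the primed side `M` factors through the diagonal matrix of `x'`.
  have hup : M.rank ≤ #{i | x' i ≠ 0} := by
    have : M = (Matrix.of fun p i => b' i p) * (Matrix.diagonal x' * Matrix.of c') := by
      ext p s
      simp only [hM, of_apply, h, mul_apply (M := Matrix.of fun p i => b' i p), diagonal_mul]
      exact sum_congr rfl fun i _ => by ring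
    rw [this]
    refine (rank_mul_le_right _ _).trans ((rank_mul_le_left _ _).trans ?_)
    rw [rank_diagonal, Fintype.card_subtype]
  -- With `g = #G` and `m_b`, `m_c` the two minima in `hx'`, Sylvester gives `M.rank ≥ min g m_b +
  -- min g m_c - g`. By `hx'` this is compatible with `hup` only if `g` is at most both minima, and
  -- then the bound reads `g ≤ M.rank`.
  have hlow := rank_add_rank_le_card_add_rank_mul (Matrix.of fun p (i : G) => b i p)
    (Matrix.diagonal (fun i : G => x i) * (Matrix.of fun s (i : G) => c i s)ᵀ)
  rw [rank_mul_eq_right_of_isUnit_det, rank_transpose, Fintype.card_coe] at hlow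
  · have : (Matrix.of fun p (i : G) => b i p) *
        (Matrix.diagonal (fun i : G => x i) * (Matrix.of fun s (i : G) => c i s)ᵀ) = M := by
      ext p s
      simp only [hM, of_apply, mul_apply (M := Matrix.of fun p (i : G) => b i p), diagonal_mul,
        transpose_apply]
      rw [← Finset.sum_subset (subset_univ G), ← Finset.sum_coe_sort G]
      · exact sum_congr rfl fun i _ => by ring
      · intro i _ hi
        have : x i = 0 := by simpa [hG] using hi
        simp [this]
    rw [this] at hlow
    have h1 := hb.le_rank G (s := min G.card (min (Fintype.card ι) (β + 1)))
      (by omega) (by omega)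
    have h2 := hc.le_rank G (s := min G.card (min (Fintype.card ι) (γ + 1)))
      (by omega) (by omega)
    omega
  · rw [det_diagonal, isUnit_iff_ne_zero, prod_ne_zero_iff]
    intro i _
    exact (mem_filter.1 i.2).2

theorem sup_span_singleton_eq {V : Type*} [AddCommGroup V] [Module F V] {W : Submodule F V}
    {g a : V} (ha : a ∈ W ⊔ F ∙ g) (haW : a ∉ W) : W ⊔ F ∙ g = W ⊔ F ∙ a := by
  obtain ⟨w, hw, y, hy, rfl⟩ := Submodule.mem_sup.1 ha
  obtain ⟨t, rfl⟩ := Submodule.mem_span_singleton.1 hy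
  have ht : t ≠ 0 := by
    rintro rfl
    exact haW (by simpa using hw)
  apply le_antisymm
  · refine sup_le le_sup_left ?_
    rw [Submodule.span_singleton_le_iff_mem]
    have : t⁻¹ • ((w + t • g) - w) = g := by simp [smul_smul, ht]
    have h2 : t⁻¹ • ((w + t • g) - w) ∈ W ⊔ F ∙ (w + t • g) := Submodule.smul_mem _ _
      (Submodule.sub_mem _ (Submodule.mem_sup_right (Submodule.mem_span_singleton_self _))
        (Submodule.mem_sup_left hw))
    rwa [this] at h2
  · refine sup_le le_sup_left ?_
    rwa [Submodule.span_singleton_le_iff_mem]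

/-- The counting half of Kruskal's permutation lemma. -/
theorem card_mem_le_card_mem [Fintype ι] {V : Type*} [AddCommGroup V] [Module F V]
    [FiniteDimensional F V] {a a' : ι → V}
    (h : ∀ x : V →ₗ[F] F, #{j | x (a' j) ≠ 0} + finrank F (Submodule.span F (Set.range a')) ≤
        Fintype.card ι + 1 → #{i | x (a i) ≠ 0} ≤ #{j | x (a' j) ≠ 0})
    (S : Set ι) :
    #{j | a' j ∈ Submodule.span F (a' '' S)} ≤ #{i | a i ∈ Submodule.span F (a' '' S)} := by
  -- Induction on the codimension of `W` in `U`; `𝒢` below consists of the spans of `W` with one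
  -- further `a' j`, which meet pairwise only in `W`.
  induction hn : finrank F (Submodule.span F (Set.range a')) -
    finrank F (Submodule.span F (a' '' S)) using Nat.strong_induction_on generalizing S with
  | _ n ih =>
  set U := Submodule.span F (Set.range a') with hU
  set W := Submodule.span F (a' '' S) with hW
  have hWU : W ≤ U := Submodule.span_mono (Set.image_subset_range _ _)
  have ha'U : ∀ j, a' j ∈ U := fun j => Submodule.subset_span ⟨j, rfl⟩
  have haU : ∀ i, a i ∈ U := by
    intro i
    by_contra hi
    obtain ⟨x, hx, hUx⟩ := Submodule.exists_le_ker_of_notMem hi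
    have h0 : #{j | x (a' j) ≠ 0} = 0 := by
      rw [card_eq_zero, filter_eq_empty_iff]
      intro j _
      simpa using hUx (ha'U j)
    have := h x (by
      rw [h0]
      have : finrank F U ≤ Fintype.card ι := finrank_range_le_card (R := F) a'
      omega)
    rw [h0, Nat.le_zero, card_eq_zero, filter_eq_empty_iff] at this
    exact this (mem_univ i) hx
  let φ : V → Submodule F V := fun g => W ⊔ F ∙ g
  let 𝒢 : Finset (Submodule F V) := ({j | a' j ∉ W} : Finset ι).image fun j => φ (a' j)
  have hmem : ∀ {G}, G ∈ 𝒢 ↔ ∃ j, a' j ∉ W ∧ φ (a' j) = G := by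
    intro G; simp [𝒢]
  -- the number of members of either family in a cover
  have hcount : ∀ (f : ι → V), ∀ G ∈ 𝒢, #{i | f i ∈ G} =
      #{i | f i ∈ W} + #{i ∈ ({i | f i ∉ W} : Finset ι) | φ (f i) = G} := by
    intro f G hG
    obtain ⟨j, hj, rfl⟩ := hmem.1 hG
    rw [← card_union_of_disjoint]
    · congr 1
      ext i
      simp only [mem_filter, mem_univ, true_and, mem_union]
      constructor
      · intro hi
        by_cases hiW : f i ∈ W
        · exact Or.inl hiW
        · exact Or.inr ⟨hiW, (sup_span_singleton_eq hi hiW).symm⟩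
      · rintro (hi | ⟨-, hi⟩)
        · exact Submodule.mem_sup_left hi
        · rw [← hi]
          exact Submodule.mem_sup_right (Submodule.mem_span_singleton_self _)
    · rw [disjoint_left]
      intro i hi hi'
      simp only [mem_filter, mem_univ, true_and] at hi hi'
      exact hi'.1 hi
  have hcompl : ∀ (f : ι → V), #{i | f i ∈ W} + #{i | f i ∉ W} = Fintype.card ι := by
    intro f
    rw [← card_univ, card_filter_add_card_filter_not]
  have hstep : ∀ G ∈ 𝒢, #{j | a' j ∈ G} ≤ #{i | a i ∈ G} := by
    intro G hG
    obtain ⟨j, hj, rfl⟩ := hmem.1 hG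
    have hSj : φ (a' j) = Submodule.span F (a' '' (insert j S)) := by
      rw [Set.image_insert_eq, Submodule.span_insert, sup_comm]
    have hlt : finrank F W < finrank F (φ (a' j)) := by
      apply Submodule.finrank_lt_finrank_of_lt
      refine lt_of_le_of_ne le_sup_left fun e => hj ?_
      rw [e]
      exact Submodule.mem_sup_right (Submodule.mem_span_singleton_self _)
    have hle : finrank F (φ (a' j)) ≤ finrank F U := by
      apply Submodule.finrank_mono
      rw [hSj]
      exact Submodule.span_mono (Set.image_subset_range _ _)
    have := ih _ (by rw [← hSj]; omega) (insert j S) rfl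
    rwa [← hSj] at this
  have hsum' : ∑ G ∈ 𝒢, #{i ∈ ({i | a' i ∉ W} : Finset ι) | φ (a' i) = G} = #{i | a' i ∉ W} :=
    (card_eq_sum_card_image _ _).symm
  have hsum : ∑ G ∈ 𝒢, #{i ∈ ({i | a i ∉ W} : Finset ι) | φ (a i) = G} ≤ #{i | a i ∉ W} :=
    (sum_card_fiberwise_eq_card_filter _ _ _).trans_le (card_filter_le _ _)
  have hc' := hcompl a'
  have hc := hcompl a
  have hle := sum_le_sum hstep
  rw [sum_congr rfl (hcount a'), sum_congr rfl (hcount a), sum_add_distrib, sum_add_distrib,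
    hsum', sum_const, sum_const, smul_eq_mul, smul_eq_mul] at hle
  obtain hN | hN | hN : #𝒢 = 0 ∨ #𝒢 = 1 ∨ 2 ≤ #𝒢 := by omega
  · have hall : ∀ j, a' j ∈ W := by
      intro j
      by_contra hj
      have : φ (a' j) ∈ 𝒢 := hmem.2 ⟨j, hj, rfl⟩
      rw [card_eq_zero] at hN
      simp [hN] at this
    have hUW : U ≤ W := Submodule.span_le.2 (by rintro _ ⟨j, rfl⟩; exact hall j)
    have : #{i | a i ∈ W} = Fintype.card ι := by
      rw [filter_true_of_mem fun i _ => hUW (haU i), card_univ]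
    omega
  · obtain ⟨G, hG⟩ := card_eq_one.1 hN
    obtain ⟨j, hj, rfl⟩ := hmem.1 (hG ▸ mem_singleton_self G)
    have hUG : U ≤ φ (a' j) := by
      refine Submodule.span_le.2 ?_
      rintro _ ⟨l, rfl⟩
      by_cases hl : a' l ∈ W
      · exact Submodule.mem_sup_left hl
      · have : φ (a' l) ∈ 𝒢 := hmem.2 ⟨l, hl, rfl⟩
        rw [hG, mem_singleton] at this
        rw [← this]
        exact Submodule.mem_sup_right (Submodule.mem_span_singleton_self _)
    -- Here `W` is a hyperplane of `U`, cut out by a form `x`. At least `finrank W` of the `a' j`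
    -- lie in `W`, so the support of `x` on `a'` is within the threshold of `h`.
    obtain ⟨x, hx, hWx⟩ := Submodule.exists_le_ker_of_notMem hj
    have hker : ∀ u ∈ U, x u = 0 ↔ u ∈ W := by
      intro u hu
      refine ⟨fun h0 => ?_, fun h0 => hWx h0⟩
      obtain ⟨w, hw, y, hy, rfl⟩ := Submodule.mem_sup.1 (hUG hu)
      obtain ⟨t, rfl⟩ := Submodule.mem_span_singleton.1 hy
      have hxw : x w = 0 := hWx hw
      rw [map_add, hxw, zero_add, map_smul, smul_eq_mul, mul_eq_zero] at h0
      rcases h0 with rfl | h0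
      · simpa using hw
      · exact absurd h0 hx
    have e1 : #{j | x (a' j) ≠ 0} = #{j | a' j ∉ W} := by
      congr 1; ext l; simp [hker _ (ha'U l)]
    have e2 : #{i | x (a i) ≠ 0} = #{i | a i ∉ W} := by
      congr 1; ext l; simp [hker _ (haU l)]
    have hdimW : finrank F W ≤ #{j | a' j ∈ W} := by
      have : W = Submodule.span F (((({j | a' j ∈ W} : Finset ι).image a' : Finset V)) : Set V) := by
        apply le_antisymm
        · refine Submodule.span_mono ?_
          rintro _ ⟨l, hl, rfl⟩
          simp only [coe_image, coe_filter, mem_univ, true_and]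
          exact ⟨l, Submodule.subset_span ⟨l, hl, rfl⟩, rfl⟩
        · refine Submodule.span_le.2 ?_
          intro y hy
          simp only [coe_image, coe_filter, mem_univ, true_and] at hy
          obtain ⟨l, hl, rfl⟩ := hy
          exact hl
      calc finrank F W ≤ #(({j | a' j ∈ W} : Finset ι).image a') := by
            conv_lhs => rw [this]
            exact finrank_span_finset_le_card _
        _ ≤ _ := card_image_le
    have hdimU : finrank F U ≤ finrank F W + 1 := by
      refine (Submodule.finrank_mono hUG).trans
        ((Submodule.finrank_add_le_finrank_add_finrank _ _).trans ?_)
      exact Nat.add_le_add_left (by simpa using finrank_span_le_card (R := F) ({a' j} : Set V)) _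
    have := h x (by rw [e1]; omega)
    rw [e1, e2] at this
    omega
  -- Summing `hstep` over the `N ≥ 2` members of `𝒢` counts vectors in `W` `N` times and each `a' j`
  -- outside `W` once (each `a i` at most once). Subtracting the total `card ι` leaves `N - 1` times
  -- the desired inequality.
  · by_contra hlt
    push Not at hlt
    obtain ⟨N, hN'⟩ := Nat.exists_eq_add_of_le' hN
    rw [hN'] at hle
    obtain ⟨δ, hδ⟩ := Nat.exists_eq_add_of_lt hlt
    rw [hδ] at hle hc'
    nlinarith

/-- One factor of Kruskal's theorem: the vectors `aᵢ` of a decomposition `∑ aᵢ ⊗ bᵢ ⊗ cᵢ` whose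
Kruskal ranks are large enough are unique up to order and scaling. -/
theorem exists_perm_smul_eq [Fintype ι] [Fintype κ] [Fintype μ] {ν : Type*} [Fintype ν]
    {a a' : ι → ν → F} {b b' : ι → κ → F} {c c' : ι → μ → F} {α β γ : ℕ}
    (ha : Separated a α) (hb : Separated b β) (hc : Separated c γ)
    (h : ∀ q p s, ∑ i, a i q * b i p * c i s = ∑ i, a' i q * b' i p * c' i s)
    (hcard : 2 * Fintype.card ι + 2 ≤ min (Fintype.card ι) (α + 1) +
      min (Fintype.card ι) (β + 1) + min (Fintype.card ι) (γ + 1)) :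
    ∃ τ : Equiv.Perm ι, ∀ j, ∃ t : F, t ≠ 0 ∧ a' j = t • a (τ j) := by
  have hx : ∀ (x : (ν → F) →ₗ[F] F) p s,
      ∑ i, x (a i) * b i p * c i s = ∑ i, x (a' i) * b' i p * c' i s := by
    intro x p s
    have : ∑ i, (b i p * c i s) • a i = ∑ i, (b' i p * c' i s) • a' i := by
      ext q
      have := h q p s
      simp only [Finset.sum_apply, Pi.smul_apply, smul_eq_mul]
      convert this using 2 <;> ring
    have := congrArg x this
    simp only [map_sum, map_smul, smul_eq_mul] at this
    convert this using 2 <;> ring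
  have hspan : Submodule.span F (Set.range a) ≤ Submodule.span F (Set.range a') := by
    rw [Submodule.span_le]
    rintro _ ⟨i, rfl⟩
    by_contra hi
    obtain ⟨x, hxi, hUx⟩ := Submodule.exists_le_ker_of_notMem hi
    have h0 : #{j | x (a' j) ≠ 0} = 0 := by
      rw [card_eq_zero, filter_eq_empty_iff]
      intro j _
      simpa using hUx (Submodule.subset_span ⟨j, rfl⟩)
    have := card_support_le hb hc (hx x) (by rw [h0]; omega)
    rw [h0, Nat.le_zero, card_eq_zero, filter_eq_empty_iff] at this
    exact this (mem_univ i) hxi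
  -- This lower bound and `hcard` turn the threshold of `card_mem_le_card_mem` into that of
  -- `card_support_le`.
  have hrank : min (Fintype.card ι) (α + 1) ≤ finrank F (Submodule.span F (Set.range a')) := by
    obtain ⟨I, -, hI⟩ := exists_subset_card_eq (s := (univ : Finset ι))
      (n := min (Fintype.card ι) (α + 1)) (min_le_left _ _)
    rw [← hI, ← Fintype.card_coe, ← finrank_span_eq_card (ha.linearIndepOn I (by omega))]
    apply Submodule.finrank_mono
    refine le_trans (Submodule.span_mono ?_) hspan
    rintro _ ⟨i, rfl⟩
    exact ⟨i, rfl⟩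
  have hcount := card_mem_le_card_mem (a := a) (a' := a') fun x hxx =>
    card_support_le hb hc (hx x) (by omega)
  have ha0 : ∀ i, a i ≠ 0 := by
    intro i hi
    obtain ⟨l, -, hl⟩ := ha ∅ i (notMem_empty _) (by simp)
    simp [hi] at hl
  have hpair : ∀ i j, ∀ t : F, a i = t • a j → i = j := by
    intro i j t hij
    by_contra hne
    obtain ⟨l, hlj, hli⟩ := ha {j} i (by simpa using hne) (by rw [card_singleton]; omega)
    rw [hij, dotProduct_smul, hlj j (mem_singleton_self j), smul_zero] at hli
    exact hli rfl
  have ha'0 : ∀ j, a' j ≠ 0 := by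
    intro j hj
    have h1 := hcount ∅
    rw [Set.image_empty, Submodule.span_empty] at h1
    have h2 : #{i | a i ∈ (⊥ : Submodule F (ν → F))} = 0 := by
      rw [card_eq_zero, filter_eq_empty_iff]
      intro i _
      simpa using ha0 i
    rw [h2, Nat.le_zero, card_eq_zero, filter_eq_empty_iff] at h1
    exact h1 (mem_univ j) (by simpa using hj)
  -- Since `hcard` forces `α ≥ 1`, distinct `a i` are never proportional. With the count for `S =
  -- {j}`, each line `F ∙ a' j` contains exactly one `a i` and no other `a' l`.
  have hone : ∀ j, #{i | a i ∈ F ∙ a' j} ≤ 1 := by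
    intro j
    rw [card_le_one]
    intro i hi l hl
    simp only [mem_filter, mem_univ, true_and, Submodule.mem_span_singleton] at hi hl
    obtain ⟨t, ht⟩ := hi
    obtain ⟨u, hu⟩ := hl
    have hu0 : u ≠ 0 := by rintro rfl; exact ha0 l (by simpa using hu.symm)
    refine hpair i l (t * u⁻¹) ?_
    rw [← ht, ← hu, smul_smul, mul_assoc, inv_mul_cancel₀ hu0, mul_one]
  have hcountj : ∀ j, #{l | a' l ∈ F ∙ a' j} ≤ #{i | a i ∈ F ∙ a' j} := by
    intro j
    simpa using hcount {j}
  have hex : ∀ j, ∃ i, a i ∈ F ∙ a' j := by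
    intro j
    have : 0 < #{i | a i ∈ F ∙ a' j} := by
      refine lt_of_lt_of_le (card_pos.2 ⟨j, ?_⟩) (hcountj j)
      simp [Submodule.mem_span_singleton_self]
    obtain ⟨i, hi⟩ := card_pos.1 this
    exact ⟨i, (mem_filter.1 hi).2⟩
  choose τ hτ using hex
  have hscale : ∀ j, ∃ t : F, t ≠ 0 ∧ a' j = t • a (τ j) := by
    intro j
    obtain ⟨t, ht⟩ := Submodule.mem_span_singleton.1 (hτ j)
    have ht0 : t ≠ 0 := by rintro rfl; exact ha0 (τ j) (by simpa using ht.symm)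
    exact ⟨t⁻¹, inv_ne_zero ht0, by rw [← ht, smul_smul, inv_mul_cancel₀ ht0, one_smul]⟩
  have hinj : Function.Injective τ := by
    intro j l hjl
    have := (hcountj j).trans (hone j)
    rw [card_le_one] at this
    refine this j (by simp [Submodule.mem_span_singleton_self]) l ?_
    obtain ⟨t, -, ht⟩ := hscale l
    simp only [mem_filter, mem_univ, true_and]
    rw [ht, ← hjl]
    exact Submodule.smul_mem _ _ (hτ j)
  exact ⟨Equiv.ofBijective τ (Finite.injective_iff_bijective.1 hinj), hscale⟩

end Kruskal

/-! ### Tensor powers and their Kruskal rank -/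

section Powers

open Finset Matrix

variable {F : Type*} [Field F] {ι κ : Type*}

/-- The entries of the `k`-th tensor power of a vector. -/
def tensorPower (k : ℕ) (v : κ → F) : (Fin k → κ) → F := fun p => ∏ t, v (p t)

/-- Freezing all indices but one at a nonzero coordinate of `v'` recovers `v'` from its tensor
power. -/
theorem exists_smul_of_tensorPower_eq_smul {k : ℕ} (hk : 0 < k) {v v' : κ → F} {t : F}
    (hv' : v' ≠ 0) (h : tensorPower k v' = t • tensorPower k v) :
    ∃ u : F, u ≠ 0 ∧ v' = u • v := by
  obtain ⟨p₀, hp₀⟩ := Function.ne_iff.1 hv'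
  obtain ⟨k, rfl⟩ := Nat.exists_eq_succ_of_ne_zero hk.ne'
  have key : ∀ p, v' p = (t * v p₀ ^ k / v' p₀ ^ k) * v p := by
    intro p
    have := congrFun h (Fin.cons p fun _ => p₀)
    simp only [tensorPower, Fin.prod_univ_succ, Pi.smul_apply, smul_eq_mul, Fin.cons_zero,
      Fin.cons_succ, prod_const, card_univ, Fintype.card_fin] at this
    have h0 : v' p₀ ^ k ≠ 0 := pow_ne_zero _ hp₀
    field_simp
    rw [this]
    ring
  refine ⟨_, ?_, funext key⟩
  intro h0
  exact hp₀ (by rw [key, h0, zero_mul]; rfl)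

theorem tensorPower_append {k l : ℕ} (v : κ → F) (p : Fin k → κ)
    (p' : Fin l → κ) :
    tensorPower (k + l) v (Fin.append p p') = tensorPower k v p * tensorPower l v p' := by
  simp [tensorPower, Fin.prod_univ_add]

variable [Fintype κ]

theorem prod_dotProduct {k : ℕ} (l : Fin k → κ → F) (v : κ → F) :
    (fun p : Fin k → κ => ∏ t, l t (p t)) ⬝ᵥ tensorPower k v = ∏ t, l t ⬝ᵥ v := by
  classical
  simp only [dotProduct, tensorPower, ← prod_mul_distrib]
  rw [prod_univ_sum]
  simp

/-- Split `S` into `k` blocks of size at most `q` and take one separating form per block. -/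
theorem Separated.exists_prod {v : ι → κ → F} {q : ℕ} (h : Separated v q) (k : ℕ) (S : Finset ι)
    (i : ι) (hi : i ∉ S) (hS : S.card ≤ k * q) :
    ∃ l : Fin k → κ → F, (∀ j ∈ S, ∏ t, l t ⬝ᵥ v j = 0) ∧ ∏ t, l t ⬝ᵥ v i ≠ 0 := by
  classical
  induction k generalizing S with
  | zero =>
    have : S = ∅ := by simpa using hS
    subst this
    exact ⟨0, by simp⟩
  | succ k ih =>
    obtain ⟨S₁, hS₁, hc⟩ := exists_subset_card_eq (s := S) (n := min S.card q) (min_le_left _ _)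
    obtain ⟨l, hl, hli⟩ := h S₁ i (fun hh => hi (hS₁ hh)) (by omega)
    obtain ⟨m, hm, hmi⟩ := ih (S \ S₁) (fun hh => hi (sdiff_subset hh)) (by
      rw [card_sdiff_of_subset hS₁]
      rw [Nat.succ_mul] at hS
      omega)
    refine ⟨Fin.cons l m, fun j hj => ?_, ?_⟩
    · rw [Fin.prod_univ_succ]
      by_cases hj₁ : j ∈ S₁
      · simp [hl j hj₁]
      · simp [hm j (mem_sdiff.2 ⟨hj, hj₁⟩)]
    · rw [Fin.prod_univ_succ]
      simpa [hli] using hmi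

theorem Separated.tensorPower {v : ι → κ → F} {q : ℕ} (h : Separated v q) (k : ℕ) :
    Separated (fun i => tensorPower k (v i)) (k * q) := by
  intro S i hi hS
  obtain ⟨l, hl, hli⟩ := h.exists_prod k S i hi hS
  refine ⟨fun p => ∏ t, l t (p t), fun j hj => ?_, ?_⟩
  · rw [prod_dotProduct, hl j hj]
  · rwa [prod_dotProduct]

theorem Separated.linearIndependent {a : ι → κ → F} {q : ℕ} [Fintype ι] (h : Separated a q)
    (hq : Fintype.card ι ≤ q + 1) {g : ι → F} (hg : ∀ p, ∑ i, g i * a i p = 0) (i : ι) :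
    g i = 0 := by
  classical
  obtain ⟨l, hl, hli⟩ := h (univ.erase i) i (notMem_erase _ _)
    (by rw [card_erase_of_mem (mem_univ i), card_univ]; omega)
  have hg' : ∑ j, g j • a j = 0 := by
    ext p
    simpa using hg p
  have := congrArg (fun y => l ⬝ᵥ y) hg'
  simp only [dotProduct_zero, dotProduct_sum, dotProduct_smul] at this
  rw [Finset.sum_eq_single i] at this
  · simpa [hli] using this
  · intro j _ hj
    rw [hl j (mem_erase.2 ⟨hj, mem_univ j⟩), smul_zero]
  · simp

end Powers

/-! ### From sums of powers to symmetric tensors -/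

section Polarization

variable {𝕜 : Type*} [RCLike 𝕜] {ι κ : Type*} [Fintype ι] [Fintype κ]

/-- If a sum of `r`-th powers of linear forms vanishes, so does the corresponding sum of tensors. -/
theorem sum_mul_tensorPower_eq_zero (r : ℕ) (u : ι → 𝕜) (v : ι → κ → 𝕜)
    (h : ∀ x, ∑ i, u i * (v i ⬝ᵥ x) ^ r = 0) (p : Fin r → κ) :
    ∑ i, u i * tensorPower r (v i) p = 0 := by
  classical
  induction r generalizing u with
  | zero => simpa [tensorPower] using h 0
  | succ r ih =>
    -- Differentiating in the coordinate direction `p 0` peels off one tensor index; characteristic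
    -- zero removes the factor `r + 1`.
    have key : ∀ x, ∑ i, (u i * v i (p 0)) * (v i ⬝ᵥ x) ^ r = 0 := by
      intro x
      have hd : HasDerivAt (fun t : 𝕜 => ∑ i, u i * (v i ⬝ᵥ (x + t • Pi.single (p 0) 1)) ^ (r + 1))
          (∑ i, u i * (((r + 1 : ℕ) : 𝕜) * (v i ⬝ᵥ x) ^ r * v i (p 0))) 0 := by
        refine HasDerivAt.fun_sum fun i _ => HasDerivAt.const_mul _ ?_
        have h1 : HasDerivAt (fun t : 𝕜 => v i ⬝ᵥ (x + t • Pi.single (p 0) 1)) (v i (p 0)) 0 := by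
          simp only [dotProduct_add, dotProduct_smul, dotProduct_single, mul_one, smul_eq_mul]
          simpa using ((hasDerivAt_id (0 : 𝕜)).mul_const (v i (p 0))).const_add (v i ⬝ᵥ x)
        simpa using h1.fun_pow (r + 1)
      simp only [h] at hd
      have h0 := hd.unique (hasDerivAt_const (0 : 𝕜) (0 : 𝕜))
      have hr : ((r + 1 : ℕ) : 𝕜) ≠ 0 := by exact_mod_cast Nat.succ_ne_zero r
      rw [← mul_right_inj' hr, mul_zero, ← h0, Finset.mul_sum]
      exact Finset.sum_congr rfl fun i _ => by ring
    have := ih (fun i => u i * v i (p 0)) key (fun t => p t.succ)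
    rw [← this]
    refine Finset.sum_congr rfl fun i _ => ?_
    simp only [tensorPower, Fin.prod_univ_succ]
    ring

end Polarization

/-! ### Full Kruskal rank for almost all parameters -/

section Genericity

open Finset Matrix Polynomial

/-- Enlarge `insert i S` to `s` indices; a column of the inverse of their minor is a form equal to
`1` at `i` and `0` at the others. -/
theorem separated_of_det_ne_zero {F ι : Type*} [Field F] [Fintype ι] {n s : ℕ}
    (v : ι → Fin n → F) (hsn : s ≤ n) (hs : s ≤ Fintype.card ι)
    (h : ∀ f : Fin s ↪ ι, (Matrix.of fun a b => v (f a) (Fin.castLE hsn b)).det ≠ 0) (hs0 : 0 < s) :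
    Separated v (s - 1) := by
  classical
  intro S i hi hS
  obtain ⟨T, hST, -, hT⟩ := exists_subsuperset_card_eq (subset_univ (insert i S)) (n := s)
    (by rw [card_insert_of_notMem hi]; omega) (by rwa [card_univ])
  let e : Fin s ≃ T := (finCongr hT.symm).trans T.equivFin.symm
  let f : Fin s ↪ ι := e.toEmbedding.trans (Function.Embedding.subtype _)
  have hf : ∀ j (hj : j ∈ T), f (e.symm ⟨j, hj⟩) = j := by
    intro j hj
    simp [f]
  set M : Matrix (Fin s) (Fin s) F := Matrix.of fun a b => v (f a) (Fin.castLE hsn b) with hM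
  have hdet : IsUnit M.det := isUnit_iff_ne_zero.2 (h f)
  have hiT : i ∈ T := hST (mem_insert_self _ _)
  set a₀ := e.symm ⟨i, hiT⟩
  set l' : Fin s → F := M⁻¹ *ᵥ Pi.single a₀ 1
  have hl' : M *ᵥ l' = Pi.single a₀ 1 := by
    rw [mulVec_mulVec, mul_nonsing_inv _ hdet, one_mulVec]
  have hdot : ∀ j (hj : j ∈ T), (∑ b, l' b • Pi.single (Fin.castLE hsn b) (1 : F)) ⬝ᵥ v j =
      (Pi.single a₀ 1 : Fin s → F) (e.symm ⟨j, hj⟩) := by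
    intro j hj
    rw [← hl', sum_dotProduct, mulVec, dotProduct]
    refine sum_congr rfl fun b _ => ?_
    rw [smul_dotProduct, single_dotProduct, one_mul, smul_eq_mul, mul_comm, hM, of_apply, hf j hj]
  refine ⟨∑ b, l' b • Pi.single (Fin.castLE hsn b) (1 : F), fun j hj => ?_, ?_⟩
  · rw [hdot j (hST (mem_insert_of_mem hj)), Pi.single_eq_of_ne]
    intro he
    have := e.symm.injective he
    rw [Subtype.mk.injEq] at this
    exact hi (this ▸ hj)
  · rw [hdot i hiT]
    simp [a₀]

/-- The determinant is a polynomial in `t` with constant coefficient `det U`. -/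
theorem finite_setOf_det_smul_add_eq_zero {F n : Type*} [Field F] [Fintype n] [DecidableEq n]
    (Z U : Matrix n n F) (hU : U.det ≠ 0) : {t : F | (t • Z + U).det = 0}.Finite := by
  set P : F[X] := ((X : F[X]) • Z.map C + U.map C).det with hP
  classical
  have hP0 : P ≠ 0 := by
    intro h0
    apply hU
    rw [← coeff_det_X_add_C_zero Z U, ← hP, h0, coeff_zero]
  refine (P.roots.toFinset.finite_toSet).subset ?_
  intro t ht
  simp only [mem_coe, Multiset.mem_toFinset, mem_roots hP0, IsRoot.def]
  rw [← show (t • Z + U).det = 0 from ht, hP, ← coe_evalRingHom, RingHom.map_det]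
  congr 1
  ext i j
  simp [mul_comm t]

variable {𝕜 : Type*} [RCLike 𝕜] {d₀ d₁ d₂ : ℕ}

/-- The rows of the first layer in homogeneous coordinates; the extra index `none` stands for the
constant function `1`. -/
def innerRow {𝕜 : Type*} [Field 𝕜] (θ : Params 𝕜 d₀ d₁ d₂) : Option (Fin d₁) → Fin (d₀ + 1) → 𝕜
  | none => Fin.cons 1 0
  | some i => Fin.cons (θ.b₁ i) (θ.W₁ i)

/-- The columns of the second layer; the extra index `none` stands for the output bias. -/
def outerCol {𝕜 : Type*} (θ : Params 𝕜 d₀ d₁ d₂) : Option (Fin d₁) → Fin d₂ → 𝕜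
  | none => θ.b₂
  | some i => fun s => θ.W₂ s i

/-- Pairwise distinct nodes indexed by `Option (Fin d)`. -/
def node (𝕜 : Type*) [Field 𝕜] {d : ℕ} : Option (Fin d) → 𝕜
  | none => 0
  | some i => (i : 𝕜) + 1

theorem node_injective (𝕜 : Type*) [Field 𝕜] [CharZero 𝕜] {d : ℕ} :
    Function.Injective (node 𝕜 : Option (Fin d) → 𝕜) := by
  rintro (_ | i) (_ | j) h
  · rfl
  · exact absurd h.symm (Nat.cast_add_one_ne_zero _)
  · exact absurd h (Nat.cast_add_one_ne_zero _)
  · simp only [node, add_left_inj, Nat.cast_inj] at h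
    rw [Fin.ext h]

/-- Parameters whose homogeneous rows and columns are of Vandermonde type. -/
def vandermondeParams (𝕜 : Type*) [Field 𝕜] (d₀ d₁ d₂ : ℕ) : Params 𝕜 d₀ d₁ d₂ :=
  ((fun i p => node 𝕜 (some i) ^ ((p : ℕ) + 1), fun s i => node 𝕜 (some i) ^ (s : ℕ)),
    (1, fun s => node 𝕜 (none : Option (Fin d₁)) ^ (s : ℕ)))

theorem det_node_ne_zero {s : ℕ} (f : Fin s ↪ Option (Fin d₁)) :
    (Matrix.of fun a b : Fin s => node 𝕜 (f a) ^ (b : ℕ)).det ≠ 0 :=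
  det_vandermonde_ne_zero_iff.2 ((node_injective 𝕜).comp f.injective)

theorem continuous_innerRow (i : Option (Fin d₁)) (p : Fin (d₀ + 1)) :
    Continuous fun θ : Params 𝕜 d₀ d₁ d₂ => innerRow θ i p := by
  rcases i with _ | i <;> refine Fin.cases ?_ (fun p => ?_) p <;>
    simp only [innerRow, Fin.cons_zero, Fin.cons_succ, Params.b₁, Params.W₁, of_apply] <;> fun_prop

theorem continuous_outerCol (i : Option (Fin d₁)) (s : Fin d₂) :
    Continuous fun θ : Params 𝕜 d₀ d₁ d₂ => outerCol θ i s := by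
  rcases i with _ | i <;> simp only [outerCol, Params.b₂, Params.W₂, of_apply] <;> fun_prop

theorem innerRow_add_smul (θ : Params 𝕜 d₀ d₁ d₂) (t : 𝕜) (i : Fin d₁) (p : Fin (d₀ + 1)) :
    innerRow (θ + t • vandermondeParams 𝕜 d₀ d₁ d₂) (some i) p =
      innerRow θ (some i) p + t * node 𝕜 (some i) ^ (p : ℕ) := by
  refine Fin.cases ?_ (fun p => ?_) p <;>
    simp [innerRow, Params.b₁, Params.W₁, vandermondeParams]

/-- The reason for giving `none` the node `0`: as `0 ^ 0 = 1`, the fixed row is itself a Vandermonde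
row. -/
theorem innerRow_none (θ : Params 𝕜 d₀ d₁ d₂) (p : Fin (d₀ + 1)) :
    innerRow θ none p = node 𝕜 (none : Option (Fin d₁)) ^ (p : ℕ) := by
  refine Fin.cases ?_ (fun p => ?_) p <;> simp [innerRow, node]

theorem outerCol_add_smul (θ : Params 𝕜 d₀ d₁ d₂) (t : 𝕜) (i : Option (Fin d₁)) (s : Fin d₂) :
    outerCol (θ + t • vandermondeParams 𝕜 d₀ d₁ d₂) i s =
      outerCol θ i s + t * node 𝕜 i ^ (s : ℕ) := by
  rcases i with _ | i <;> simp [outerCol, Params.b₂, Params.W₂, vandermondeParams]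

variable [MeasureSpace 𝕜] [BorelSpace 𝕜]
  [(volume : Measure 𝕜).IsAddHaarMeasure]

theorem ae_det_ne_zero {E : Type*} [NormedAddCommGroup E] [NormedSpace 𝕜 E] [MeasurableSpace E]
    [BorelSpace E] [LocallyCompactSpace E] (μ : Measure E) [μ.IsAddHaarMeasure]
    {s : ℕ} (Y : E → Matrix (Fin s) (Fin s) 𝕜) (hY : Continuous Y) (u : E)
    (U : Matrix (Fin s) (Fin s) 𝕜) (hU : U.det ≠ 0) (Z : E → Matrix (Fin s) (Fin s) 𝕜)
    (h : ∀ θ, ∀ t : 𝕜, t ≠ 0 → ∃ c : Fin s → 𝕜,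
      Matrix.diagonal c * (t⁻¹ • Z θ + U) = Y (θ + t • u) ∧ ∀ a, c a ≠ 0) :
    ∀ᵐ θ ∂μ, (Y θ).det ≠ 0 := by
  have hopen : IsOpen {θ | (Y θ).det ≠ 0} := isOpen_ne_fun hY.matrix_det continuous_const
  -- A Fubini argument: every line in direction `u` meets the zero set of the determinant in
  -- finitely many points.
  refine (ae_ae_add_linearMap_mem_iff (LinearMap.toSpanSingleton 𝕜 E u) (volume : Measure 𝕜) μ
    hopen.measurableSet).1 (Filter.Eventually.of_forall fun θ => ?_)
  have hfin : ({0} ∪ (fun t : 𝕜 => t⁻¹) '' {t | (t • Z θ + U).det = 0}).Finite :=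
    (Set.finite_singleton 0).union ((finite_setOf_det_smul_add_eq_zero (Z θ) U hU).image _)
  refine measure_mono_null ?_ (hfin.measure_zero volume)
  intro t ht
  simp only [Set.mem_compl_iff, Set.mem_ofPred_eq, LinearMap.toSpanSingleton_apply, not_not] at ht
  by_cases ht0 : t = 0
  · exact Or.inl ht0
  refine Or.inr ⟨t⁻¹, ?_, inv_inv t⟩
  obtain ⟨c, hc, hc0⟩ := h θ t ht0
  rw [← hc, det_mul, det_diagonal, mul_eq_zero, prod_eq_zero_iff] at ht
  rcases ht with ⟨a, -, ha⟩ | ht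
  · exact absurd ha (hc0 a)
  · exact ht

instance instBorelSpaceParams : BorelSpace (Params 𝕜 d₀ d₁ d₂) := Prod.borelSpace

instance instIsAddHaarMeasureParams :
    (volume : Measure (Params 𝕜 d₀ d₁ d₂)).IsAddHaarMeasure := by
  have hpi : ∀ m n, (volume : Measure (Fin m → Fin n → 𝕜)).IsAddHaarMeasure := fun m n =>
    Measure.pi.isAddHaarMeasure _
  have h₁ := hpi d₁ d₀
  have h₂ := hpi d₂ d₁
  have : (volume : Measure ((Fin d₁ → Fin d₀ → 𝕜) × (Fin d₂ → Fin d₁ → 𝕜))).IsAddHaarMeasure :=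
    Measure.prod.instIsAddHaarMeasure _ _
  have : (volume : Measure ((Fin d₁ → 𝕜) × (Fin d₂ → 𝕜))).IsAddHaarMeasure :=
    Measure.prod.instIsAddHaarMeasure _ _
  have : MeasurableAdd ((Fin d₁ → Fin d₀ → 𝕜) × (Fin d₂ → Fin d₁ → 𝕜)) :=
    ContinuousAdd.measurableAdd
  have : MeasurableAdd ((Fin d₁ → 𝕜) × (Fin d₂ → 𝕜)) := ContinuousAdd.measurableAdd
  exact Measure.prod.instIsAddHaarMeasure _ _

theorem ae_separated_innerRow : ∀ᵐ θ : Params 𝕜 d₀ d₁ d₂ ∂volume,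
    Separated (innerRow θ) (min (d₁ + 1) (d₀ + 1) - 1) := by
  set s := min (d₁ + 1) (d₀ + 1) with hs
  have hsn : s ≤ d₀ + 1 := min_le_right _ _
  have key : ∀ f : Fin s ↪ Option (Fin d₁), ∀ᵐ θ : Params 𝕜 d₀ d₁ d₂ ∂volume,
      (Matrix.of fun a b => innerRow θ (f a) (Fin.castLE hsn b)).det ≠ 0 := by
    intro f
    refine ae_det_ne_zero (𝕜 := 𝕜) (E := Params 𝕜 d₀ d₁ d₂) volume
      (fun θ => Matrix.of fun a b => innerRow θ (f a) (Fin.castLE hsn b))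
      (continuous_matrix fun a b => continuous_innerRow _ _) (vandermondeParams 𝕜 d₀ d₁ d₂)
      (Matrix.of fun a b : Fin s => node 𝕜 (f a) ^ (b : ℕ)) (det_node_ne_zero f)
      -- The row of `none` does not move with `θ`, so it gets `Z`-row `0` and scale `1`.
      (fun θ => Matrix.of fun a b =>
        if f a = none then 0 else innerRow θ (f a) (Fin.castLE hsn b)) ?_
    intro θ t ht
    refine ⟨fun a => if f a = none then 1 else t, ?_, fun a => ?_⟩
    · ext a b
      simp only [diagonal_mul, Matrix.add_apply, Matrix.smul_apply, of_apply, smul_eq_mul]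
      rcases hfa : f a with _ | i
      · simp [innerRow_none]
      · simp only [reduceCtorEq, if_false, innerRow_add_smul, Fin.val_castLE]
        field_simp
    · dsimp only
      split_ifs
      · exact one_ne_zero
      · exact ht
  filter_upwards [ae_all_iff.2 key] with θ hθ
  exact separated_of_det_ne_zero _ hsn (by simp [hs]) hθ (by omega)

theorem ae_separated_outerCol (h₂ : 0 < d₂) : ∀ᵐ θ : Params 𝕜 d₀ d₁ d₂ ∂volume,
    Separated (outerCol θ) (min (d₁ + 1) d₂ - 1) := by
  set s := min (d₁ + 1) d₂ with hs
  have hsn : s ≤ d₂ := min_le_right _ _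
  have key : ∀ f : Fin s ↪ Option (Fin d₁), ∀ᵐ θ : Params 𝕜 d₀ d₁ d₂ ∂volume,
      (Matrix.of fun a b => outerCol θ (f a) (Fin.castLE hsn b)).det ≠ 0 := by
    intro f
    refine ae_det_ne_zero (𝕜 := 𝕜) (E := Params 𝕜 d₀ d₁ d₂) volume
      (fun θ => Matrix.of fun a b => outerCol θ (f a) (Fin.castLE hsn b))
      (continuous_matrix fun a b => continuous_outerCol _ _) (vandermondeParams 𝕜 d₀ d₁ d₂)
      (Matrix.of fun a b : Fin s => node 𝕜 (f a) ^ (b : ℕ)) (det_node_ne_zero f)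
      (fun θ => Matrix.of fun a b => outerCol θ (f a) (Fin.castLE hsn b)) ?_
    intro θ t ht
    refine ⟨fun _ => t, ?_, fun _ => ht⟩
    ext a b
    simp only [diagonal_mul, Matrix.add_apply, Matrix.smul_apply, of_apply, smul_eq_mul,
      outerCol_add_smul, Fin.val_castLE]
    field_simp
  filter_upwards [ae_all_iff.2 key] with θ hθ
  exact separated_of_det_ne_zero _ hsn (by simp [hs]) hθ (by omega)

end Genericity

/-! ### From Kruskal's theorem to uniqueness of the network -/

section Uniqueness

open Finset Matrix

variable {𝕜 : Type*} [RCLike 𝕜] {d₀ d₁ d₂ : ℕ}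

theorem network_apply (r : ℕ) (θ : Params 𝕜 d₀ d₁ d₂) (x : Fin d₀ → 𝕜) (s : Fin d₂) :
    network r θ x s =
      ∑ i, outerCol θ i s * (innerRow θ i ⬝ᵥ (Fin.cons 1 x : Fin (d₀ + 1) → 𝕜)) ^ r := by
  rw [Fintype.sum_option]
  simp [network, outerCol, innerRow, mulVec, dotProduct, activation, Fin.sum_univ_succ, add_comm]

theorem sum_outerCol_mul_pow_eq {r : ℕ} {θ θ' : Params 𝕜 d₀ d₁ d₂}
    (h : network r θ' = network r θ) (s : Fin d₂) (x : Fin (d₀ + 1) → 𝕜) :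
    ∑ i, outerCol θ i s * (innerRow θ i ⬝ᵥ x) ^ r =
      ∑ i, outerCol θ' i s * (innerRow θ' i ⬝ᵥ x) ^ r := by
  -- Rescaling handles a nonzero homogenizing coordinate; continuity extends the identity to zero.
  have hne : ∀ t : 𝕜, t ≠ 0 → ∀ y : Fin d₀ → 𝕜,
      ∑ i, outerCol θ i s * (innerRow θ i ⬝ᵥ (Fin.cons t y : Fin (d₀ + 1) → 𝕜)) ^ r =
        ∑ i, outerCol θ' i s * (innerRow θ' i ⬝ᵥ (Fin.cons t y : Fin (d₀ + 1) → 𝕜)) ^ r := by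
    intro t ht y
    have hy : (Fin.cons t y : Fin (d₀ + 1) → 𝕜) =
        t • (Fin.cons 1 (t⁻¹ • y) : Fin (d₀ + 1) → 𝕜) := by
      ext p
      refine Fin.cases ?_ (fun p => ?_) p <;> simp [ht]
    have h1 := congrFun (congrFun h (t⁻¹ • y)) s
    rw [network_apply, network_apply] at h1
    simp only [hy, dotProduct_smul, smul_eq_mul, mul_pow, mul_left_comm _ (t ^ r), ← Finset.mul_sum]
    rw [h1]
  have hc : ∀ η : Params 𝕜 d₀ d₁ d₂, Continuous fun t : 𝕜 => ∑ i, outerCol η i s *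
      (innerRow η i ⬝ᵥ (Fin.cons t (Fin.tail x) : Fin (d₀ + 1) → 𝕜)) ^ r := by
    intro η
    simp only [dotProduct, Fin.sum_univ_succ, Fin.cons_zero, Fin.cons_succ]
    fun_prop
  have := congrFun (Continuous.ext_on (dense_compl_singleton (0 : 𝕜)) (hc θ) (hc θ')
    fun t ht => hne t ht (Fin.tail x)) (x 0)
  simpa only [Fin.cons_self_tail] using this

theorem sum_outerCol_mul_tensorPower_eq {r : ℕ} {θ θ' : Params 𝕜 d₀ d₁ d₂}
    (h : network r θ' = network r θ) (s : Fin d₂) (p : Fin r → Fin (d₀ + 1)) :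
    ∑ i, outerCol θ i s * tensorPower r (innerRow θ i) p =
      ∑ i, outerCol θ' i s * tensorPower r (innerRow θ' i) p := by
  have := sum_mul_tensorPower_eq_zero r
    (Sum.elim (fun i => outerCol θ i s) (fun i => -outerCol θ' i s))
    (Sum.elim (innerRow θ) (innerRow θ')) (fun x => by
      simp [sum_outerCol_mul_pow_eq h s x]) p
  rw [Fintype.sum_sum_type] at this
  simpa only [Sum.elim_inl, Sum.elim_inr, neg_mul, sum_neg_distrib, add_neg_eq_zero] using this

theorem hasUniqueRepresentation_of_separated {k l q : ℕ} (hk : 0 < k) (hkl : k ≤ l)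
    (h₁ : 2 ≤ d₁) (h₂ : 2 ≤ d₂)
    {θ : Params 𝕜 d₀ d₁ d₂} (hv : Separated (innerRow θ) q)
    (hw : Separated (outerCol θ) (min (d₁ + 1) d₂ - 1))
    (hq : 2 * (d₁ + 1) ≤ 2 * (k * q) + min (d₁ + 1) d₂) :
    HasUniqueRepresentation (k + l) θ := by
  intro θ' hθ'
  have hT := sum_outerCol_mul_tensorPower_eq hθ'
  have hcard : Fintype.card (Option (Fin d₁)) = d₁ + 1 := by simp
  have hq1 : 1 ≤ q := by
    rcases Nat.eq_zero_or_pos q with rfl | h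
    · omega
    · exact h
  have hlq : k * q ≤ l * q := Nat.mul_le_mul_right q hkl
  obtain ⟨τ, hτ⟩ := exists_perm_smul_eq (a := fun i => tensorPower k (innerRow θ i))
    (a' := fun i => tensorPower k (innerRow θ' i)) (b := fun i => tensorPower l (innerRow θ i))
    (b' := fun i => tensorPower l (innerRow θ' i)) (c := outerCol θ) (c' := outerCol θ')
    (hv.tensorPower k) ((hv.tensorPower l).mono hlq) hw
    (fun p p' s => by
      have := hT s (Fin.append p p')
      simp only [tensorPower_append] at this
      convert this using 2 <;> ring)
    -- If `k * q + 1 ≤ d₁ + 1`, this is `hq`; otherwise the first two minima are full and the third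
    -- is at least `2`.
    (by rw [hcard]; omega)
  have hrow'0 : ∀ j, innerRow θ' j ≠ 0 := by
    intro j hj
    obtain ⟨t, ht, he⟩ := hτ j
    obtain ⟨m, -, hm⟩ := hv.tensorPower k ∅ (τ j) (notMem_empty _) (by simp)
    have : tensorPower k (innerRow θ (τ j)) = 0 := by
      rw [← inv_smul_smul₀ ht (tensorPower k (innerRow θ (τ j))), ← he, hj]
      ext p
      simp [tensorPower, hk.ne']
    simp [this] at hm
  have hsc : ∀ j, ∃ u : 𝕜, u ≠ 0 ∧ innerRow θ' j = u • innerRow θ (τ j) := fun j => by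
    obtain ⟨t, -, he⟩ := hτ j
    exact exists_smul_of_tensorPower_eq_smul hk (hrow'0 j) he
  choose u hu0 hu using hsc
  -- Both networks share the row of `none`, and distinct rows of `θ` are not proportional.
  have hnone : τ none = none := by
    by_contra hne
    obtain ⟨m, hm, hm'⟩ := hv {τ none} none (by simpa using Ne.symm hne) (by simpa using hq1)
    have h1 : innerRow θ none = innerRow θ' none := rfl
    rw [h1, hu, dotProduct_smul, hm _ (mem_singleton_self _), smul_zero] at hm'
    exact hm' rfl
  have hunone : u none = 1 := by
    have := congrFun (hu none) 0
    rw [hnone] at this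
    simpa [innerRow] using this.symm
  -- the second layer
  have hcol : ∀ j s, outerCol θ (τ j) s = u j ^ (k + l) * outerCol θ' j s := by
    intro j s
    -- From `hq`, `d₁ + 1 ≤ 2 * (k * q) ≤ (k + l) * q`, so the `(k + l)`-th powers are independent
    -- and their coefficients can be compared.
    have hlin := (hv.tensorPower (k + l)).linearIndependent (by
        rw [hcard, add_mul]
        omega) (g := fun i => outerCol θ i s - u (τ.symm i) ^ (k + l) * outerCol θ' (τ.symm i) s)
      (fun p => by
        simp only [sub_mul, sum_sub_distrib]
        rw [hT s p, sub_eq_zero, ← Equiv.sum_comp τ (fun i => u (τ.symm i) ^ (k + l) *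
          outerCol θ' (τ.symm i) s * tensorPower (k + l) (innerRow θ i) p)]
        refine sum_congr rfl fun j _ => ?_
        rw [Equiv.symm_apply_apply, hu]
        simp only [tensorPower, Pi.smul_apply, smul_eq_mul, prod_mul_distrib, prod_const,
          card_univ, Fintype.card_fin]
        ring) (τ j)
    simpa [sub_eq_zero] using hlin
  let σ : Equiv.Perm (Fin d₁) := Equiv.removeNone τ
  have hσ : ∀ i, τ (some i) = some (σ i) := by
    intro i
    refine (Equiv.removeNone_some τ ?_).symm
    rw [← Option.ne_none_iff_exists']
    intro h
    exact absurd (τ.injective (h.trans hnone.symm)) (by simp)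
  have hus : ∀ i p, innerRow θ' (some i) p = u (some i) * innerRow θ (some (σ i)) p := by
    intro i p
    rw [hu, hσ]
    rfl
  -- In `P D` the scaling precedes the permutation, hence the index `σ.symm i`.
  refine ⟨σ, fun i => u (some (σ.symm i)), fun i => hu0 _, ?_, ?_, ?_, ?_⟩
  · ext i p
    have := hus i p.succ
    simp only [innerRow, Fin.cons_succ] at this
    rw [Matrix.mul_assoc, Equiv.Perm.permMatrix, PEquiv.toMatrix_toPEquiv_mul]
    simp [this]
  · ext i
    have := hus i 0
    simp only [innerRow, Fin.cons_zero] at this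
    rw [← mulVec_mulVec, permMatrix_mulVec]
    simp [mulVec_diagonal, this]
  · ext s i
    have := hcol (some i) s
    rw [hσ] at this
    simp only [outerCol] at this
    rw [transpose_permMatrix, Equiv.Perm.permMatrix, PEquiv.mul_toMatrix_toPEquiv]
    have h0 := hu0 (some i)
    simp only [submatrix_apply, id, mul_diagonal]
    rw [show (Equiv.symm σ⁻¹ : Equiv.Perm (Fin d₁)) = σ from rfl, this]
    rw [Equiv.symm_apply_apply]
    field_simp
  · ext s
    have := hcol none s
    rw [hnone, hunone, one_pow, one_mul] at this
    exact this.symm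

theorem identifiable_of_le [MeasureSpace 𝕜] [BorelSpace 𝕜]
    [(volume : Measure 𝕜).IsAddHaarMeasure] {r : ℕ} (h₁ : 2 ≤ d₁) (h₂ : 2 ≤ d₂)
    (hr : 2 ≤ r)
    (hq : 2 * (d₁ + 1) ≤ 2 * (r / 2 * (min (d₁ + 1) (d₀ + 1) - 1)) + min (d₁ + 1) d₂) :
    Identifiable 𝕜 d₀ d₁ d₂ r := by
  obtain ⟨l, hl⟩ : ∃ l, r = r / 2 + l := ⟨r - r / 2, by omega⟩
  have key : ∀ᵐ θ : Params 𝕜 d₀ d₁ d₂ ∂volume, HasUniqueRepresentation (r / 2 + l) θ := by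
    filter_upwards [ae_separated_innerRow, ae_separated_outerCol (by omega)] with θ hv hw
    exact hasUniqueRepresentation_of_separated (by omega) (by omega) h₁ h₂ hv hw hq
  rwa [← hl] at key

end Uniqueness

end PNN

theorem mainTheorem12 (d₀ d₁ d₂ r : ℕ) (h₀ : 2 ≤ d₀) (h₁ : 2 ≤ d₁) (h₂ : 2 ≤ d₂) (hr : 2 ≤ r)
    (hdeg : (r : ℤ) ≥
      2 * ⌈(2 * ((d₁ : ℚ) + 1) - min ((d₁ : ℚ) + 1) (d₂ : ℚ)) /
        (2 * min ((d₁ : ℚ) + 1) ((d₀ : ℚ) + 1) - 2)⌉) :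
    PNN.Identifiable ℝ d₀ d₁ d₂ r ∧ PNN.Identifiable ℂ d₀ d₁ d₂ r := by
  have hq : 2 * (d₁ + 1) ≤ 2 * (r / 2 * (min (d₁ + 1) (d₀ + 1) - 1)) + min (d₁ + 1) d₂ := by
    obtain ⟨q, hq⟩ : ∃ q, min (d₁ + 1) (d₀ + 1) = q + 1 := ⟨min d₁ d₀, by omega⟩
    have hq0 : 0 < q := by omega
    have e₀ : min ((d₁ : ℚ) + 1) ((d₀ : ℚ) + 1) = q + 1 := by exact_mod_cast hq
    have e₂ : min ((d₁ : ℚ) + 1) (d₂ : ℚ) = (min (d₁ + 1) d₂ : ℕ) := by push_cast; rfl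
    rw [e₀, e₂] at hdeg
    -- The ceiling is an integer, so rounding `r / 2` down loses nothing.
    have hc := (Int.ceil_le (z := ((r / 2 : ℕ) : ℤ))).1 (by omega :
      ⌈(2 * ((d₁ : ℚ) + 1) - (min (d₁ + 1) d₂ : ℕ)) / (2 * ((q : ℚ) + 1) - 2)⌉ ≤ ((r / 2 : ℕ) : ℤ))
    have hqpos : (0 : ℚ) < 2 * ((q : ℚ) + 1) - 2 := by
      have : (0 : ℚ) < q := by exact_mod_cast hq0
      linarith
    rw [div_le_iff₀ hqpos] at hc
    rw [hq, Nat.add_sub_cancel]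
    have : (2 * ((d₁ : ℚ) + 1)) ≤ 2 * (((r / 2 : ℕ) : ℚ) * q) + (min (d₁ + 1) d₂ : ℕ) := by
      rw [Int.cast_natCast] at hc
      linarith
    exact_mod_cast this
  exact ⟨PNN.identifiable_of_le h₁ h₂ hr hq, PNN.identifiable_of_le h₁ h₂ hr hq⟩
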